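/- Let $\mathbb{E}_1,\mathbb{E}_2$ be finite-dimensional Euclidean spaces, let $\mathcal{M}\subset\mathbb{E}_1$ be a compact (nonempty) smooth embedded submanifold with the Riemannian metric induced from $\mathbb{E}_1$, and let $S\subset\mathbb{E}_2$ be a nonempty compact convex set. Let $f:\mathbb{E}_1\times\mathbb{E}_2\to\mathbb{R}$ be continuously differentiable with $f(x,\cdot)$ concave for every $x\in\mathbb{E}_1$, and let $h:\mathbb{E}_1\to\mathbb{R}$ and $g:\mathbb{E}_2\to\mathbb{R}$ be convex (possibly nonsmooth). Assume that there are constants $L_x,L_y>0$ and $L_h\ge 0$ such that $$\|\nabla_x f(x_1,y)-\nabla_x f(x_2,y)\|\le L_x\|x_1-x_2\|\qquad\text{for all }x_1,x_2\in\mathcal{M},\ y\in S,$$ $$\|\nabla_y f(x_1,y_1)-\nabla_y f(x_2,y_2)\|^2\le L_y^2\big(\|x_1-x_2\|^2+\|y_1-y_2\|^2\big)\qquad\text{for all }(x_1,y_1),(x_2,y_2)\in\mathcal{M}\times S,$$ and $h$ is $L_h$-Lipschitz continuous. Consider the problem $$\min_{x\in\mathcal{M}}\max_{y\in S}\; f(x,y)+h(x)-g(y),$$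 and let $\Phi(x):=\max_{y\in S}\{f(x,y)-g(y)\}$ for $x\in\mathbb{E}_1$. For a real-valued function $\varphi$ on a Euclidean space, $\partial\varphi(x)=\{z\mid\langle z,v\rangle\le\varphi^\circ(x;v)\ \forall v\}$ denotes the Clarke subdifferential, where $\varphi^\circ(x;v)=\limsup_{z\to x,\,t\downarrow0}\frac{\varphi(z+tv)-\varphi(z)}{t}$. Let $N_x\mathcal{M}$ be the normal space of $\mathcal{M}$ at $x\in\mathcal{M}$, i.e. the orthogonal complement of the tangent space $T_x\mathcal{M}$ in $\mathbb{E}_1$, and for $y\in S$ let $N_yS=\{z\mid\langle z,v\rangle\le0\ \text{whenever}\ d_S^\circ(y;v)=0\}$ be the normal cone of $S$ at $y$, where $d_S$ is the distance to $S$. A point $x^*\in\mathcal{M}$ is *optimization-stationary* if $$0\in\partial\Phi(x^*)+\partial h(x^*)+N_{x^*}\mathcal{M},$$ and a pair $(x^*,y^*)\in\mathcal{M}\times S$ is *game-stationary* if $$0\in\nabla_x f(x^*,y^*)+\partial h(x^*)+N_{x^*}\mathcal{M}\qquad\text{and}\qquad 0\in\nabla_y f(x^*,y^*)-\partial g(y^*)-N_{y^*}S.$$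 Then a point $x^*$ is optimization-stationary if and only if there exists $y^*\in S$ such that $(x^*,y^*)$ is game-stationary. -/

import Mathlib

open Filter Topology
open scoped Pointwise ContDiff

noncomputable section

namespace MinimaxManifold

section Submanifold

variable {E : Type*} [NormedAddCommGroup E] [InnerProductSpace ℝ E]

/-- `ψ : U → ℝ^k` is a local defining function for `M` at the point `x ∈ M`: `U` is an open
neighbourhood of `x`, `ψ` is smooth on `U`, `M ∩ U` is the zero set of `ψ` in `U`, and the
differential of `ψ` at `x` has rank `k`. For `k = 0` this says exactly that `U ⊆ M`. -/
structure IsLocalDefiningFunction (M : Set E) (x : E) {k : ℕ} (U : Set E)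
    (ψ : E → EuclideanSpace ℝ (Fin k)) : Prop where
  mem : x ∈ M
  isOpen : IsOpen U
  mem_nhd : x ∈ U
  smooth : ContDiffOn ℝ ∞ ψ U
  zero_iff : ∀ y ∈ U, ψ y = 0 ↔ y ∈ M
  rank_eq : Module.finrank ℝ (LinearMap.range (fderiv ℝ ψ x : E →ₗ[ℝ] EuclideanSpace ℝ (Fin k))) = k

/-- `M` is an embedded submanifold of `E` of dimension `n`: it is nonempty and has, with
`k = dim E - n`, a local defining function into `ℝ^k` at each of its points.
The case `k = 0` says that `M` is open in `E`. -/
def IsEmbeddedSubmanifold (n : ℕ) (M : Set E) : Prop :=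
  M.Nonempty ∧ ∃ k : ℕ, n + k = Module.finrank ℝ E ∧
    ∀ x ∈ M, ∃ (U : Set E) (ψ : E → EuclideanSpace ℝ (Fin k)), IsLocalDefiningFunction M x U ψ

/-- The tangent space `T_x M = ker Dψ(x)`, where `ψ` is a local defining function for `M` at `x`.
(All local defining functions at `x` have the same kernel; we take the common kernel of all of
them so that no choice is involved. When `M` is open this is the whole space.) -/
def tangentSpace (M : Set E) (x : E) : Submodule ℝ E :=
  ⨅ (k : ℕ) (U : Set E) (ψ : E → EuclideanSpace ℝ (Fin k)) (_ : IsLocalDefiningFunction M x U ψ),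
    LinearMap.ker (fderiv ℝ ψ x : E →ₗ[ℝ] EuclideanSpace ℝ (Fin k))

/-- The normal space `N_x M`, the orthogonal complement of the tangent space `T_x M` in `E`. -/
def normalSpace (M : Set E) (x : E) : Submodule ℝ E := (tangentSpace M x)ᗮ

end Submanifold

section Clarke

variable {E : Type*} [NormedAddCommGroup E] [InnerProductSpace ℝ E]

/-- The Clarke generalized directional derivative
`φ°(x; v) = limsup_{z → x, t ↓ 0} (φ (z + t v) - φ z) / t`, as an extended real number. -/
def clarkeDirDeriv (φ : E → ℝ) (x v : E) : EReal :=
  limsup (fun p : E × ℝ => (((φ (p.1 + p.2 • v) - φ p.1) / p.2 : ℝ) : EReal))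
    (𝓝 x ×ˢ 𝓝[>] (0 : ℝ))

/-- The Clarke generalized subdifferential `∂φ(x) = {z | ⟨z, v⟩ ≤ φ°(x; v) for all v}`. -/
def clarkeSubdifferential (φ : E → ℝ) (x : E) : Set E :=
  {z | ∀ v : E, ((inner ℝ z v : ℝ) : EReal) ≤ clarkeDirDeriv φ x v}

/-- The Clarke tangent cone `{v | d_C°(x; v) = 0}`, where `d_C` is the distance to `C`. -/
def clarkeTangentCone (C : Set E) (x : E) : Set E :=
  {v | clarkeDirDeriv (fun z => Metric.infDist z C) x v = 0}

/-- The normal cone to `C` at `x`, the polar of the tangent cone. -/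
def clarkeNormalCone (C : Set E) (x : E) : Set E :=
  {z | ∀ v ∈ clarkeTangentCone C x, inner ℝ z v ≤ 0}

end Clarke

section Problem

variable {E₁ E₂ : Type*}
  [NormedAddCommGroup E₁] [InnerProductSpace ℝ E₁] [FiniteDimensional ℝ E₁]
  [NormedAddCommGroup E₂] [InnerProductSpace ℝ E₂] [FiniteDimensional ℝ E₂]

/-- The partial gradient `∇_x f(x, y)`. -/
def gradX (f : E₁ → E₂ → ℝ) (x : E₁) (y : E₂) : E₁ :=
  haveI : CompleteSpace E₁ := FiniteDimensional.complete ℝ E₁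
  gradient (fun x' => f x' y) x

/-- The partial gradient `∇_y f(x, y)`. -/
def gradY (f : E₁ → E₂ → ℝ) (x : E₁) (y : E₂) : E₂ :=
  haveI : CompleteSpace E₂ := FiniteDimensional.complete ℝ E₂
  gradient (fun y' => f x y') y

/-- The value function `Φ(x) = max_{y ∈ S} f(x, y) - g(y)`. (For `S` nonempty and compact and
`f`, `g` continuous the supremum is attained.) -/
def valueFunction {E₁ E₂ : Type*} (S : Set E₂) (f : E₁ → E₂ → ℝ) (g : E₂ → ℝ) (x : E₁) : ℝ :=
  sSup ((fun y => f x y - g y) '' S)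

/-- `x` is an optimization-stationary point of `min_{x ∈ M} max_{y ∈ S} f(x, y) + h(x) - g(y)`:
`x ∈ M` and `0 ∈ ∂Φ(x) + ∂h(x) + N_x M`. -/
def IsOptimizationStationary {E₁ E₂ : Type*} [NormedAddCommGroup E₁] [InnerProductSpace ℝ E₁]
    (M : Set E₁) (S : Set E₂) (f : E₁ → E₂ → ℝ) (h : E₁ → ℝ) (g : E₂ → ℝ) (x : E₁) : Prop :=
  x ∈ M ∧
    (0 : E₁) ∈ clarkeSubdifferential (valueFunction S f g) x + clarkeSubdifferential h x
      + (normalSpace M x : Set E₁)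

/-- `(x, y)` is a game-stationary point of `min_{x ∈ M} max_{y ∈ S} f(x, y) + h(x) - g(y)`:
`(x, y) ∈ M × S`, `0 ∈ ∇_x f(x, y) + ∂h(x) + N_x M` and `0 ∈ ∇_y f(x, y) - ∂g(y) - N_y S`. -/
structure IsGameStationary (M : Set E₁) (S : Set E₂) (f : E₁ → E₂ → ℝ) (h : E₁ → ℝ)
    (g : E₂ → ℝ) (x : E₁) (y : E₂) : Prop where
  mem_left : x ∈ M
  mem_right : y ∈ S
  stationary_left :
    (0 : E₁) ∈ {gradX f x y} + clarkeSubdifferential h x + (normalSpace M x : Set E₁)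
  stationary_right :
    (0 : E₂) ∈ {gradY f x y} - clarkeSubdifferential g y - clarkeNormalCone S y

end Problem

end MinimaxManifold

end

/-! Since `f x - g` is concave and `S` is convex, the second game-stationarity condition says
exactly that `y` maximizes `f x - g` over `S` (`isMaxOn_iff_zero_mem`). The equivalence thus reduces
to Danskin's formula: `∂Φ(x)` is the set of `∇ₓf(x, y)` over these maximizers
(`clarkeSubdifferential_valueFunction`). In general only the convex hull of these gradients appears;
here concavity in `y` at every `x'` makes the set convex already (`convex_image_gradX`), so each
Clarke subgradient comes from a single `y`. The terms `∂h` and the normal space are carried along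
unchanged. -/

namespace MinimaxManifold

/-! ### Clarke objects in the convex case -/

section ClarkeCalculus

variable {E : Type*} [NormedAddCommGroup E] [InnerProductSpace ℝ E]

theorem limsup_slope_le_clarkeDirDeriv (φ : E → ℝ) (x v : E) :
    limsup (fun t : ℝ => (((φ (x + t • v) - φ x) / t : ℝ) : EReal)) (𝓝[>] (0 : ℝ))
      ≤ clarkeDirDeriv φ x v := by
  have hT : Tendsto (fun t : ℝ => (x, t)) (𝓝[>] (0 : ℝ)) (𝓝 x ×ˢ 𝓝[>] (0 : ℝ)) :=
    tendsto_const_nhds.prodMk tendsto_id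
  exact limsSup_le_limsSup_of_le (map_mono (m := fun p : E × ℝ =>
    (((φ (p.1 + p.2 • v) - φ p.1) / p.2 : ℝ) : EReal)) hT)

/-- Freezing the base point at `x` can only lower the limsup, so a one-sided minorant at `x`
suffices to certify a Clarke subgradient. -/
theorem le_clarkeDirDeriv_of_tendsto {φ : E → ℝ} {x v : E} {u : ℝ → ℝ} {c : ℝ}
    (hu : Tendsto u (𝓝[>] 0) (𝓝 c))
    (h : ∀ᶠ t in 𝓝[>] (0 : ℝ), u t ≤ (φ (x + t • v) - φ x) / t) :
    (c : EReal) ≤ clarkeDirDeriv φ x v := by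
  refine le_trans ?_ (limsup_slope_le_clarkeDirDeriv φ x v)
  rw [← ((continuous_coe_real_ereal.tendsto c).comp hu).limsup_eq]
  exact limsup_le_limsup (h.mono fun t ht => EReal.coe_le_coe_iff.2 ht)

theorem eventually_slope_lt_of_clarkeDirDeriv_lt {φ : E → ℝ} {x v : E} {c : ℝ}
    (h : clarkeDirDeriv φ x v < c) :
    ∀ᶠ t in 𝓝[>] (0 : ℝ), (φ (x + t • v) - φ x) / t < c :=
  (eventually_lt_of_limsup_lt ((limsup_slope_le_clarkeDirDeriv φ x v).trans_lt h)).mono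
    fun _ ht => EReal.coe_lt_coe_iff.1 ht

/-- The Clarke directional derivative of a continuous convex function is at most the increment. -/
theorem clarkeDirDeriv_le_sub_of_convexOn {φ : E → ℝ} (hφ : ConvexOn ℝ Set.univ φ)
    (hc : Continuous φ) (x v : E) :
    clarkeDirDeriv φ x v ≤ ((φ (x + v) - φ x : ℝ) : EReal) := by
  have hT : Tendsto (fun p : E × ℝ => ((φ (p.1 + v) - φ p.1 : ℝ) : EReal))
      (𝓝 x ×ˢ 𝓝[>] (0 : ℝ)) (𝓝 ((φ (x + v) - φ x : ℝ) : EReal)) := by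
    have h1 : Continuous fun z : E => ((φ (z + v) - φ z : ℝ) : EReal) :=
      continuous_coe_real_ereal.comp (by fun_prop)
    exact (h1.tendsto x).comp tendsto_fst
  rw [← hT.limsup_eq]
  refine limsup_le_limsup ?_
  have hI : ∀ᶠ t in 𝓝[>] (0 : ℝ), t ∈ Set.Ioc (0 : ℝ) 1 := Ioc_mem_nhdsGT one_pos
  filter_upwards [tendsto_snd.eventually hI] with p hp
  obtain ⟨h0, h1⟩ := hp
  refine EReal.coe_le_coe_iff.2 ((div_le_iff₀ h0).2 ?_)
  have := hφ.2 (Set.mem_univ p.1) (Set.mem_univ (p.1 + v)) (sub_nonneg.2 h1) h0.le (by ring)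
  have e : (1 - p.2) • p.1 + p.2 • (p.1 + v) = p.1 + p.2 • v := by module
  rw [e] at this
  simp only [smul_eq_mul] at this
  linarith

/-- For continuous convex functions the Clarke subgradients are the subgradients of convex
analysis. -/
theorem mem_clarkeSubdifferential_iff_of_convexOn {φ : E → ℝ} (hφ : ConvexOn ℝ Set.univ φ)
    (hc : Continuous φ) {x z : E} :
    z ∈ clarkeSubdifferential φ x ↔ ∀ w, φ x + inner ℝ z (w - x) ≤ φ w := by
  constructor
  · intro hz w
    have := EReal.coe_le_coe_iff.1
      ((hz (w - x)).trans (clarkeDirDeriv_le_sub_of_convexOn hφ hc x (w - x)))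
    rw [add_sub_cancel] at this
    linarith
  · intro hz v
    refine le_clarkeDirDeriv_of_tendsto tendsto_const_nhds ?_
    filter_upwards [self_mem_nhdsWithin] with t ht
    rw [le_div_iff₀ ht]
    have := hz (x + t • v)
    rw [add_sub_cancel_left, real_inner_smul_right] at this
    linarith

theorem convexOn_univ_infDist {S : Set E} (hS : Convex ℝ S) (hne : S.Nonempty) :
    ConvexOn ℝ Set.univ fun z => Metric.infDist z S := by
  refine ⟨convex_univ, fun x _ y _ a b ha hb hab => ?_⟩
  refine le_of_forall_pos_le_add fun ε hε => ?_
  obtain ⟨u, hu, hxu⟩ := (Metric.infDist_lt_iff hne).1 (lt_add_of_pos_right (Metric.infDist x S) hε)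
  obtain ⟨w, hw, hyw⟩ := (Metric.infDist_lt_iff hne).1 (lt_add_of_pos_right (Metric.infDist y S) hε)
  refine (Metric.infDist_le_dist_of_mem (hS hu hw ha hb hab)).trans ?_
  rw [dist_eq_norm] at *
  have e : a • x + b • y - (a • u + b • w) = a • (x - u) + b • (y - w) := by module
  rw [e]
  refine (norm_add_le _ _).trans ?_
  rw [norm_smul, norm_smul, Real.norm_of_nonneg ha, Real.norm_of_nonneg hb, smul_eq_mul,
    smul_eq_mul]
  have h1 := mul_le_mul_of_nonneg_left hxu.le ha
  have h2 := mul_le_mul_of_nonneg_left hyw.le hb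
  have h3 : a * ε + b * ε = ε := by rw [← add_mul, hab, one_mul]
  linarith

/-- For convex sets the Clarke normal cone is the normal cone of convex analysis. -/
theorem mem_clarkeNormalCone_iff_of_convex {S : Set E} (hS : Convex ℝ S) {y z : E} (hy : y ∈ S) :
    z ∈ clarkeNormalCone S y ↔ ∀ w ∈ S, inner ℝ z (w - y) ≤ 0 := by
  have hy0 : Metric.infDist y S = 0 := Metric.infDist_zero_of_mem hy
  constructor
  · intro hz w hw
    refine hz _ (le_antisymm ?_ ?_)
    · have := clarkeDirDeriv_le_sub_of_convexOn (convexOn_univ_infDist hS ⟨y, hy⟩)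
        (Metric.continuous_infDist_pt S) y (w - y)
      simpa [hy0, Metric.infDist_zero_of_mem hw] using this
    · refine le_clarkeDirDeriv_of_tendsto (c := 0) tendsto_const_nhds ?_
      filter_upwards [self_mem_nhdsWithin] with t ht
      rw [hy0, sub_zero]
      exact div_nonneg Metric.infDist_nonneg (le_of_lt ht)
  · intro hz v hv
    refine le_of_forall_pos_le_add fun ε hε => ?_
    rw [zero_add]
    -- The `+ 1` covers `z = 0`. A slope below this constant puts `y + t • v` so close to `S` that
    -- the pairing with `z` errs by at most `ε * t`.
    have hδ : 0 < ε / (‖z‖ + 1) := by positivity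
    have hlt : clarkeDirDeriv (fun w => Metric.infDist w S) y v < ((ε / (‖z‖ + 1) : ℝ) : EReal) := by
      rw [show clarkeDirDeriv (fun w => Metric.infDist w S) y v = 0 from hv]
      exact EReal.coe_pos.2 hδ
    obtain ⟨t, ht, ht0⟩ :=
      ((eventually_slope_lt_of_clarkeDirDeriv_lt hlt).and self_mem_nhdsWithin).exists
    have ht0 : 0 < t := ht0
    rw [hy0, sub_zero, div_lt_iff₀ ht0] at ht
    obtain ⟨w, hw, hd⟩ := (Metric.infDist_lt_iff ⟨y, hy⟩).1 ht
    have h1 := hz w hw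
    have h2 : inner ℝ z (y + t • v - w) ≤ ‖z‖ * (ε / (‖z‖ + 1) * t) :=
      (real_inner_le_norm _ _).trans
        (mul_le_mul_of_nonneg_left (by rw [← dist_eq_norm]; exact hd.le) (norm_nonneg z))
    have h3 : inner ℝ z (t • v) = inner ℝ z (y + t • v - w) + inner ℝ z (w - y) := by
      rw [← inner_add_right]; congr 1; abel
    rw [real_inner_smul_right] at h3
    have h4 : ‖z‖ * (ε / (‖z‖ + 1) * t) ≤ ε * t := by
      have : ‖z‖ * (ε / (‖z‖ + 1)) ≤ ε := by
        rw [mul_div_assoc', div_le_iff₀ (by positivity)]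
        nlinarith
      calc _ = ‖z‖ * (ε / (‖z‖ + 1)) * t := by ring
        _ ≤ _ := mul_le_mul_of_nonneg_right this ht0.le
    refine le_of_mul_le_mul_left ?_ ht0
    linarith

end ClarkeCalculus

/-! ### Subgradient condition for constrained convex minimization -/

section Optimality

variable {E : Type*} [NormedAddCommGroup E] [InnerProductSpace ℝ E] [CompleteSpace E]

/-- A minimizer over a convex set of a continuous convex function admits a subgradient whose
negative is normal to the set. -/
theorem exists_subgradient_of_isMinOn {G : E → ℝ} (hG : ConvexOn ℝ Set.univ G)
    (hc : Continuous G) {S : Set E} (hS : Convex ℝ S) {y : E} (hy : y ∈ S) (hmin : IsMinOn G S y) :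
    ∃ p : E, (∀ w, G y + inner ℝ p (w - y) ≤ G w) ∧ ∀ w ∈ S, 0 ≤ inner ℝ p (w - y) := by
  -- The strict epigraph is open, so it can be separated from `S ×ˢ Iic (G y)` even if `S` has empty
  -- interior.
  have hA : Convex ℝ {q : E × ℝ | G q.1 < q.2} := by
    simpa using hG.convex_strict_epigraph
  have hAo : IsOpen {q : E × ℝ | G q.1 < q.2} :=
    isOpen_lt (hc.comp continuous_fst) continuous_snd
  have hdisj : Disjoint {q : E × ℝ | G q.1 < q.2} (S ×ˢ Set.Iic (G y)) := by
    rw [Set.disjoint_left]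
    rintro ⟨w, r⟩ hw ⟨hwS, hr⟩
    exact absurd ((hmin hwS).trans_lt (lt_of_lt_of_le hw (Set.mem_Iic.1 hr))) (lt_irrefl _)
  obtain ⟨l, u, hlA, hlB⟩ := geometric_hahn_banach_open hA hAo (hS.prod (convex_Iic (G y))) hdisj
  set s : ℝ := l (0, 1) with hs
  set q : E := (InnerProductSpace.toDual ℝ E).symm (l.comp (ContinuousLinearMap.inl ℝ E ℝ)) with hq
  have hl : ∀ w r, l (w, r) = inner ℝ q w + r * s := by
    intro w r
    rw [hq, InnerProductSpace.toDual_symm_apply, ContinuousLinearMap.comp_apply,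
      ContinuousLinearMap.inl_apply, hs, ← smul_eq_mul, ← map_smul, ← map_add]
    simp
  have h1 : ∀ w r, G w < r → inner ℝ q w + r * s < u := fun w r h => hl w r ▸ hlA (w, r) h
  have h2 : ∀ w ∈ S, u ≤ inner ℝ q w + G y * s := fun w hw =>
    hl w (G y) ▸ hlB (w, G y) ⟨hw, le_refl (G y)⟩
  -- The hyperplane is not vertical: compare `(y, G y + 1)` with `(y, G y)`.
  have hs0 : s < 0 := by
    have a := h1 y (G y + 1) (by linarith)
    have b := h2 y hy
    linarith
  have h3 : ∀ w, inner ℝ q w + G w * s ≤ u := by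
    intro w
    refine le_of_forall_pos_le_add fun ε hε => ?_
    have := h1 w (G w + ε / (-s)) (lt_add_of_pos_right _ (div_pos hε (neg_pos.2 hs0)))
    have e : (G w + ε / (-s)) * s = G w * s - ε := by
      have := hs0.ne
      field_simp
      ring
    linarith
  refine ⟨(-s)⁻¹ • q, fun w => ?_, fun w hw => ?_⟩
  · have a := h3 w
    have b := h2 y hy
    rw [real_inner_smul_left, inner_sub_right, inv_mul_eq_div, ← le_sub_iff_add_le',
      div_le_iff₀ (neg_pos.2 hs0)]
    linarith
  · have a := h3 y
    have b := h2 w hw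
    rw [real_inner_smul_left, inner_sub_right]
    exact mul_nonneg (inv_nonneg.2 (neg_pos.2 hs0).le) (by linarith)

end Optimality

/-! ### The value function and its maximizers -/

section ValueFunction

variable {X Y : Type*} {f : X → Y → ℝ} {g : Y → ℝ} {S : Set Y}

theorem valueFunction_eq_of_isMaxOn {x : X} {y : Y} (hy : y ∈ S)
    (hmax : IsMaxOn (fun y' => f x y' - g y') S y) : valueFunction S f g x = f x y - g y :=
  IsGreatest.csSup_eq ⟨⟨y, hy, rfl⟩, Set.forall_mem_image.2 fun _ hw => hmax hw⟩

variable [TopologicalSpace X] [TopologicalSpace Y]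

theorem continuous_payoff (hf : Continuous fun p : X × Y => f p.1 p.2) (hg : Continuous g)
    (x : X) : Continuous fun y => f x y - g y :=
  (hf.comp (by fun_prop : Continuous fun y : Y => (x, y))).sub hg

theorem le_valueFunction (hf : Continuous fun p : X × Y => f p.1 p.2) (hg : Continuous g)
    (hS : IsCompact S) (x : X) {y : Y} (hy : y ∈ S) : f x y - g y ≤ valueFunction S f g x :=
  le_csSup (hS.bddAbove_image (continuous_payoff hf hg x).continuousOn) ⟨y, hy, rfl⟩

theorem exists_isMaxOn (hf : Continuous fun p : X × Y => f p.1 p.2) (hg : Continuous g)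
    (hS : IsCompact S) (hne : S.Nonempty) (x : X) :
    ∃ y ∈ S, IsMaxOn (fun y' => f x y' - g y') S y :=
  hS.exists_isMaxOn hne (continuous_payoff hf hg x).continuousOn

end ValueFunction

/-! ### Partial derivatives of a jointly `C¹` function -/

section PartialDerivatives

variable {E₁ E₂ : Type*} [NormedAddCommGroup E₁] [NormedSpace ℝ E₁] [NormedAddCommGroup E₂]
  [NormedSpace ℝ E₂] {f : E₁ → E₂ → ℝ}

theorem hasFDerivAt_left (hf : ContDiff ℝ 1 fun p : E₁ × E₂ => f p.1 p.2) (x : E₁) (y : E₂) :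
    HasFDerivAt (fun x' => f x' y)
      ((fderiv ℝ (fun p : E₁ × E₂ => f p.1 p.2) (x, y)).comp (ContinuousLinearMap.inl ℝ E₁ E₂))
      x :=
  HasFDerivAt.comp x (g := fun p : E₁ × E₂ => f p.1 p.2) (f := fun x' => (x', y))
    ((hf.differentiable one_ne_zero) (x, y)).hasFDerivAt (hasFDerivAt_prodMk_left x y)

theorem hasFDerivAt_right (hf : ContDiff ℝ 1 fun p : E₁ × E₂ => f p.1 p.2) (x : E₁) (y : E₂) :
    HasFDerivAt (f x)
      ((fderiv ℝ (fun p : E₁ × E₂ => f p.1 p.2) (x, y)).comp (ContinuousLinearMap.inr ℝ E₁ E₂))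
      y :=
  HasFDerivAt.comp y (g := fun p : E₁ × E₂ => f p.1 p.2) (f := fun y' => (x, y'))
    ((hf.differentiable one_ne_zero) (x, y)).hasFDerivAt (hasFDerivAt_prodMk_right x y)

end PartialDerivatives

/-! ### First-order conditions in `y` -/

section FirstOrderConditions

variable {E₁ E₂ : Type*} [NormedAddCommGroup E₁] [NormedSpace ℝ E₁] [NormedAddCommGroup E₂]
  [InnerProductSpace ℝ E₂] [FiniteDimensional ℝ E₂] {f : E₁ → E₂ → ℝ} {g : E₂ → ℝ} {S : Set E₂}

theorem tendsto_slope_gradY (hf : ContDiff ℝ 1 fun p : E₁ × E₂ => f p.1 p.2) (x : E₁) (y v : E₂) :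
    Tendsto (fun t : ℝ => (f x (y + t • v) - f x y) / t) (𝓝[>] 0)
      (𝓝 (inner ℝ (gradY f x y) v)) := by
  have h := hasFDerivAt_right hf x y
  have hslope := (h.hasLineDerivAt v).tendsto_slope_zero_right
  have : CompleteSpace E₂ := FiniteDimensional.complete ℝ E₂
  rw [gradY, inner_gradient_left, h.fderiv]
  simpa [div_eq_inv_mul] using hslope

/-- The gradient inequality for a differentiable concave function. -/
theorem concave_le_add_inner_gradY (hf : ContDiff ℝ 1 fun p : E₁ × E₂ => f p.1 p.2) {x : E₁}
    (hconc : ConcaveOn ℝ Set.univ (f x)) (y w : E₂) :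
    f x w ≤ f x y + inner ℝ (gradY f x y) (w - y) := by
  have : f x w - f x y ≤ inner ℝ (gradY f x y) (w - y) := by
    refine ge_of_tendsto (tendsto_slope_gradY hf x y (w - y)) ?_
    filter_upwards [Ioc_mem_nhdsGT (one_pos (α := ℝ))] with t ht
    rw [le_div_iff₀ ht.1]
    have h1 := hconc.2 (Set.mem_univ y) (Set.mem_univ w) (sub_nonneg.2 ht.2) ht.1.le (by ring)
    have e : (1 - t) • y + t • w = y + t • (w - y) := by module
    rw [e] at h1
    simp only [smul_eq_mul] at h1
    linarith
  linarith

/-- First-order characterization of the maximizers of `f x - g` over a convex set. -/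
theorem isMaxOn_iff_zero_mem (hf : ContDiff ℝ 1 fun p : E₁ × E₂ => f p.1 p.2) {x : E₁}
    (hconc : ConcaveOn ℝ Set.univ (f x)) (hg : ConvexOn ℝ Set.univ g) (hS : Convex ℝ S) {y : E₂}
    (hy : y ∈ S) :
    IsMaxOn (fun y' => f x y' - g y') S y ↔
      (0 : E₂) ∈ {gradY f x y} - clarkeSubdifferential g y - clarkeNormalCone S y := by
  have : CompleteSpace E₂ := FiniteDimensional.complete ℝ E₂
  have hgc : Continuous g := hg.locallyLipschitz.continuous
  constructor
  · intro hmax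
    set a := gradY f x y with ha
    -- Replacing `f x` by its linearization at `y` leaves a convex problem that `y` still solves.
    have hG : ConvexOn ℝ Set.univ fun w => g w + -(inner ℝ a w) := by
      refine hg.add ⟨convex_univ, fun u _ w _ b c _ _ _ => le_of_eq ?_⟩
      simp only [inner_add_right, real_inner_smul_right, smul_eq_mul]
      ring
    have hmin : IsMinOn (fun w => g w + -(inner ℝ a w)) S y := by
      intro w hw
      have key : inner ℝ a (w - y) ≤ g w - g y := by
        refine le_of_tendsto (tendsto_slope_gradY hf x y (w - y)) ?_
        filter_upwards [Ioc_mem_nhdsGT (one_pos (α := ℝ))] with t ht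
        rw [div_le_iff₀ ht.1]
        have e : (1 - t) • y + t • w = y + t • (w - y) := by module
        have h1 := hg.2 (Set.mem_univ y) (Set.mem_univ w) (sub_nonneg.2 ht.2) ht.1.le (by ring)
        have h2 := hmax (hS hy hw (sub_nonneg.2 ht.2) ht.1.le (by ring))
        change f x _ - g _ ≤ f x y - g y at h2
        rw [e] at h1 h2
        simp only [smul_eq_mul] at h1
        linarith
      rw [inner_sub_right] at key
      show g y + -(inner ℝ a y) ≤ g w + -(inner ℝ a w)
      linarith
    obtain ⟨p, hp, hpS⟩ := exists_subgradient_of_isMinOn hG (by fun_prop) hS hy hmin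
    -- Adding back the linear term turns `p` into a subgradient `a + p` of `g`, while `-p` is normal
    -- to `S`.
    refine Set.mem_sub.2 ⟨a - (a + p), Set.sub_mem_sub rfl ?_, -p, ?_, by abel⟩
    · rw [mem_clarkeSubdifferential_iff_of_convexOn hg hgc]
      intro w
      have := hp w
      rw [inner_add_left, inner_sub_right a]
      linarith
    · rw [mem_clarkeNormalCone_iff_of_convex hS hy]
      intro w hw
      rw [inner_neg_left]
      linarith [hpS w hw]
  · intro h0
    obtain ⟨c, hc, m, hm, hcm⟩ := Set.mem_sub.1 h0
    obtain ⟨a, rfl, b, hb, rfl⟩ := Set.mem_sub.1 hc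
    rw [mem_clarkeSubdifferential_iff_of_convexOn hg hgc] at hb
    rw [mem_clarkeNormalCone_iff_of_convex hS hy] at hm
    intro w hw
    have e : gradY f x y = b + m := by rw [← sub_eq_zero, ← hcm]; abel
    have h1 := concave_le_add_inner_gradY hf hconc y w
    rw [e, inner_add_left] at h1
    show f x w - g w ≤ f x y - g y
    linarith [hb w, hm w hw]

end FirstOrderConditions

/-! ### Danskin's theorem -/

section Danskin

variable {E₁ E₂ : Type*}
  [NormedAddCommGroup E₁] [InnerProductSpace ℝ E₁] [FiniteDimensional ℝ E₁]
  [NormedAddCommGroup E₂] [InnerProductSpace ℝ E₂]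
  {f : E₁ → E₂ → ℝ} {g : E₂ → ℝ} {S : Set E₂}

theorem inner_gradX (hf : ContDiff ℝ 1 fun p : E₁ × E₂ => f p.1 p.2) (x : E₁) (y : E₂) (v : E₁) :
    inner ℝ (gradX f x y) v = fderiv ℝ (fun p : E₁ × E₂ => f p.1 p.2) (x, y) (v, 0) := by
  have : CompleteSpace E₁ := FiniteDimensional.complete ℝ E₁
  rw [gradX, inner_gradient_left, (hasFDerivAt_left hf x y).fderiv]
  simp

theorem continuous_gradX (hf : ContDiff ℝ 1 fun p : E₁ × E₂ => f p.1 p.2) (x : E₁) :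
    Continuous (gradX f x) := by
  have : CompleteSpace E₁ := FiniteDimensional.complete ℝ E₁
  have h : gradX f x = fun y => (InnerProductSpace.toDual ℝ E₁).symm
      ((fderiv ℝ (fun p : E₁ × E₂ => f p.1 p.2) (x, y)).comp
        (ContinuousLinearMap.inl ℝ E₁ E₂)) := by
    funext y
    rw [gradX, gradient, (hasFDerivAt_left hf x y).fderiv]
  rw [h]
  have h1 := hf.continuous_fderiv one_ne_zero
  refine (LinearIsometryEquiv.continuous _).comp ?_
  exact (h1.comp (by fun_prop : Continuous fun y : E₂ => (x, y))).clm_comp continuous_const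

theorem tendsto_slope_gradX (hf : ContDiff ℝ 1 fun p : E₁ × E₂ => f p.1 p.2) (x : E₁) (y : E₂)
    (v : E₁) :
    Tendsto (fun t : ℝ => (f (x + t • v) y - f x y) / t) (𝓝[>] 0)
      (𝓝 (inner ℝ (gradX f x y) v)) := by
  have hslope := ((hasFDerivAt_left hf x y).hasLineDerivAt v).tendsto_slope_zero_right
  rw [inner_gradX hf]
  simpa [div_eq_inv_mul] using hslope

/-- The function `f · y - g y` lies below `Φ` and touches it at `x`, so its slopes at `x` minorize
those of `Φ`. -/
theorem gradX_mem_clarkeSubdifferential (hf : ContDiff ℝ 1 fun p : E₁ × E₂ => f p.1 p.2)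
    (hg : Continuous g) (hS : IsCompact S) {x : E₁} {y : E₂} (hy : y ∈ S)
    (hmax : IsMaxOn (fun y' => f x y' - g y') S y) :
    gradX f x y ∈ clarkeSubdifferential (valueFunction S f g) x := by
  intro v
  refine le_clarkeDirDeriv_of_tendsto (tendsto_slope_gradX hf x y v) ?_
  filter_upwards [self_mem_nhdsWithin] with t ht
  refine div_le_div_of_nonneg_right ?_ (le_of_lt ht)
  rw [valueFunction_eq_of_isMaxOn hy hmax]
  linarith [le_valueFunction hf.continuous hg hS (x + t • v) hy]

/-- The upper estimate in Danskin's theorem. -/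
theorem clarkeDirDeriv_valueFunction_le (hf : ContDiff ℝ 1 fun p : E₁ × E₂ => f p.1 p.2)
    (hg : Continuous g) (hS : IsCompact S) (hne : S.Nonempty) {x v : E₁} {c : ℝ}
    (hc : ∀ y ∈ S, IsMaxOn (fun y' => f x y' - g y') S y → inner ℝ (gradX f x y) v < c) :
    clarkeDirDeriv (valueFunction S f g) x v ≤ c := by
  have hfc := hf.continuous
  have key : ∀ᶠ p : E₁ × ℝ in 𝓝 (x, 0), ∀ y ∈ S, 0 < p.2 →
      IsMaxOn (fun y' => f (p.1 + p.2 • v) y' - g y') S y →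
      f (p.1 + p.2 • v) y - f p.1 y ≤ p.2 * c := by
    -- Compactness of `S` makes a local estimate around each `(x, 0, y)` uniform in `y`.
    refine hS.eventually_forall_of_forall_eventually (P := fun (p : E₁ × ℝ) (y : E₂) => 0 < p.2 →
      IsMaxOn (fun y' => f (p.1 + p.2 • v) y' - g y') S y →
      f (p.1 + p.2 • v) y - f p.1 y ≤ p.2 * c) fun y hy => ?_
    by_cases hmax : IsMaxOn (fun y' => f x y' - g y') S y
    · have hlt := sub_pos.2 (hc y hy hmax)
      set δ := (c - inner ℝ (gradX f x y) v) / (‖v‖ + 1) with hδ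
      have hδ0 : 0 < δ := by positivity
      -- Strict differentiability is needed because the base point of the Clarke quotient moves.
      have hstrict := (hf.contDiffAt.hasStrictFDerivAt (x := (x, y)) one_ne_zero).isLittleO.def hδ0
      have hT : Tendsto (fun q : (E₁ × ℝ) × E₂ =>
          ((q.1.1 + q.1.2 • v, q.2), (q.1.1, q.2))) (𝓝 ((x, 0), y)) (𝓝 ((x, y), (x, y))) := by
        have : Continuous fun q : (E₁ × ℝ) × E₂ =>
          ((q.1.1 + q.1.2 • v, q.2), (q.1.1, q.2)) := by fun_prop
        simpa using this.tendsto ((x, 0), y)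
      filter_upwards [hT.eventually hstrict] with q hq h0 _
      have e : ((q.1.1 + q.1.2 • v, q.2) : E₁ × E₂) - (q.1.1, q.2) = q.1.2 • (v, 0) := by
        simp
      rw [e, map_smul, ← inner_gradX hf, norm_smul, Real.norm_of_nonneg h0.le, Prod.norm_mk,
        norm_zero, max_eq_left (norm_nonneg v), smul_eq_mul] at hq
      have h1 := (le_abs_self _).trans hq
      have h2 : δ * ‖v‖ ≤ c - inner ℝ (gradX f x y) v := by
        rw [hδ, div_mul_eq_mul_div, div_le_iff₀ (by positivity)]
        nlinarith
      have h3 := mul_le_mul_of_nonneg_left h2 h0.le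
      linarith
    -- If `y` is strictly beaten by `y₀` at `x`, it remains so nearby, and the claim is vacuous.
    · simp only [IsMaxOn, IsMaxFilter, eventually_principal, not_forall, not_le] at hmax
      obtain ⟨y₀, hy₀, hlt⟩ := hmax
      have h1 : Continuous fun q : (E₁ × ℝ) × E₂ => f (q.1.1 + q.1.2 • v) q.2 - g q.2 :=
        (hfc.comp (by fun_prop : Continuous fun q : (E₁ × ℝ) × E₂ =>
          (q.1.1 + q.1.2 • v, q.2))).sub (hg.comp continuous_snd)
      have h2 : Continuous fun q : (E₁ × ℝ) × E₂ => f (q.1.1 + q.1.2 • v) y₀ - g y₀ :=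
        (hfc.comp (by fun_prop : Continuous fun q : (E₁ × ℝ) × E₂ =>
          (q.1.1 + q.1.2 • v, y₀))).sub continuous_const
      have h3 := (h1.tendsto ((x, 0), y)).eventually_lt (h2.tendsto ((x, 0), y)) (by simpa using hlt)
      filter_upwards [h3] with q hq _ hm
      exact absurd (hm hy₀) (not_le.2 hq)
  refine limsup_le_of_le (by isBoundedDefault) ?_
  have hle : 𝓝 x ×ˢ 𝓝[>] (0 : ℝ) ≤ 𝓝 (x, 0) := by
    rw [nhds_prod_eq]
    exact prod_mono_right _ nhdsWithin_le_nhds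
  have hpos : ∀ᶠ t in 𝓝[>] (0 : ℝ), 0 < t := self_mem_nhdsWithin
  filter_upwards [hle key, tendsto_snd.eventually hpos] with p hp h0
  -- A maximizer at the displaced point bounds the increment of `Φ` by that of `f · y`.
  obtain ⟨y, hy, hm⟩ := exists_isMaxOn hfc hg hS hne (p.1 + p.2 • v)
  rw [EReal.coe_le_coe_iff, div_le_iff₀ h0, valueFunction_eq_of_isMaxOn hy hm]
  linarith [hp y hy h0 hm, le_valueFunction hfc hg hS p.1 hy]

/-- For `f` concave in the second variable, the partial gradients at the maximizers form a convex
set: the map `y ↦ ∇ₓ f (x, y)` is affine on the set of maximizers. -/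
theorem convex_image_gradX (hf : ContDiff ℝ 1 fun p : E₁ × E₂ => f p.1 p.2)
    (hconc : ∀ x : E₁, ConcaveOn ℝ Set.univ (f x)) (hg : ConvexOn ℝ Set.univ g) (hS : Convex ℝ S)
    (x : E₁) :
    Convex ℝ (gradX f x '' {y | y ∈ S ∧ IsMaxOn (fun y' => f x y' - g y') S y}) := by
  rintro _ ⟨y₁, ⟨hy₁, hm₁⟩, rfl⟩ _ ⟨y₂, ⟨hy₂, hm₂⟩, rfl⟩ a b ha hb hab
  have hy := hS hy₁ hy₂ ha hb hab
  set y := a • y₁ + b • y₂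
  have hf_le : ∀ x', a * f x' y₁ + b * f x' y₂ ≤ f x' y := fun x' =>
    (hconc x').2 (Set.mem_univ y₁) (Set.mem_univ y₂) ha hb hab
  have hg_le : g y ≤ a * g y₁ + b * g y₂ :=
    hg.2 (Set.mem_univ y₁) (Set.mem_univ y₂) ha hb hab
  have h12 : f x y₁ - g y₁ = f x y₂ - g y₂ := le_antisymm (hm₂ hy₁) (hm₁ hy₂)
  have hsum : a * (f x y₁ - g y₁) + b * (f x y₂ - g y₂) = f x y₁ - g y₁ := by
    rw [← h12, ← add_mul, hab, one_mul]
  have hle : f x y - g y ≤ f x y₁ - g y₁ := hm₁ hy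
  have hfx := hf_le x
  have hfeq : f x y = a * f x y₁ + b * f x y₂ := by linarith
  refine ⟨y, ⟨hy, fun w hw => ?_⟩, ?_⟩
  · have hw' : f x w - g w ≤ f x y₁ - g y₁ := hm₁ hw
    show f x w - g w ≤ f x y - g y
    linarith
  -- The concavity gap is nonnegative for all `x'` and vanishes at `x`, so its derivative there is
  -- zero.
  · have hmin : IsLocalMin (fun x' => f x' y - (a * f x' y₁ + b * f x' y₂)) x := by
      refine Eventually.of_forall fun x' => ?_
      show f x y - (a * f x y₁ + b * f x y₂) ≤ f x' y - (a * f x' y₁ + b * f x' y₂)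
      linarith [hf_le x']
    have hD := (hasFDerivAt_left hf x y).sub (((hasFDerivAt_left hf x y₁).const_mul a).add
      ((hasFDerivAt_left hf x y₂).const_mul b))
    have h0 := hmin.hasFDerivAt_eq_zero hD
    refine ext_inner_right ℝ fun v => ?_
    have h1 := DFunLike.congr_fun h0 v
    rw [inner_add_left, real_inner_smul_left, real_inner_smul_left, inner_gradX hf, inner_gradX hf,
      inner_gradX hf]
    simp at h1
    linarith

variable [FiniteDimensional ℝ E₂]

/-- **Danskin's theorem** for `f` concave in the second variable: the Clarke subdifferential of the
value function consists of the partial gradients at the maximizers. -/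
theorem clarkeSubdifferential_valueFunction (hf : ContDiff ℝ 1 fun p : E₁ × E₂ => f p.1 p.2)
    (hconc : ∀ x : E₁, ConcaveOn ℝ Set.univ (f x)) (hg : ConvexOn ℝ Set.univ g) (hS : Convex ℝ S)
    (hSc : IsCompact S) (hne : S.Nonempty) (x : E₁) :
    clarkeSubdifferential (valueFunction S f g) x =
      gradX f x '' {y | y ∈ S ∧ IsMaxOn (fun y' => f x y' - g y') S y} := by
  have : CompleteSpace E₁ := FiniteDimensional.complete ℝ E₁
  have hgc : Continuous g := hg.locallyLipschitz.continuous
  refine Set.Subset.antisymm (fun z hz => ?_) ?_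
  · by_contra hzK
    have hc : Continuous fun y => f x y - g y :=
      continuous_payoff hf.continuous hgc x
    have hcl : IsClosed {y | IsMaxOn (fun y' => f x y' - g y') S y} := by
      simp only [IsMaxOn, IsMaxFilter, eventually_principal, Set.ofPred_forall]
      exact isClosed_biInter fun w _ => isClosed_le continuous_const hc
    have hK : IsCompact (gradX f x '' {y | y ∈ S ∧ IsMaxOn (fun y' => f x y' - g y') S y}) :=
      (hSc.inter_right hcl).image (continuous_gradX hf x)
    -- A strictly separating direction contradicts the upper estimate for the Clarke derivative.
    obtain ⟨l, c, hlt, hcz⟩ := geometric_hahn_banach_closed_point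
      (convex_image_gradX hf hconc hg hS x) hK.isClosed hzK
    have hl : ∀ w, l w = inner ℝ w ((InnerProductSpace.toDual ℝ E₁).symm l) := fun w => by
      rw [real_inner_comm, InnerProductSpace.toDual_symm_apply]
    have h1 := (hz _).trans (clarkeDirDeriv_valueFunction_le hf hgc hSc hne
      (v := (InnerProductSpace.toDual ℝ E₁).symm l) (c := c)
      fun y hy hm => hl _ ▸ hlt _ ⟨y, ⟨hy, hm⟩, rfl⟩)
    rw [← hl] at h1
    exact absurd (EReal.coe_le_coe_iff.1 h1) (not_le.2 hcz)
  · rintro _ ⟨y, ⟨hy, hm⟩, rfl⟩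
    exact gradX_mem_clarkeSubdifferential hf hgc hSc hy hm

end Danskin

end MinimaxManifold

theorem mainTheorem4
    {E₁ E₂ : Type*}
    [NormedAddCommGroup E₁] [InnerProductSpace ℝ E₁] [FiniteDimensional ℝ E₁]
    [NormedAddCommGroup E₂] [InnerProductSpace ℝ E₂] [FiniteDimensional ℝ E₂]
    -- the compact Riemannian submanifold `M` and the compact convex set `S`
    (n : ℕ) (M : Set E₁) (hM : MinimaxManifold.IsEmbeddedSubmanifold n M) (hMc : IsCompact M)
    (S : Set E₂) (hSne : S.Nonempty) (hSconv : Convex ℝ S) (hSc : IsCompact S)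
    -- the functions `f`, `h` and `g`
    (f : E₁ → E₂ → ℝ) (hf : ContDiff ℝ 1 (fun p : E₁ × E₂ => f p.1 p.2))
    (hfconc : ∀ x : E₁, ConcaveOn ℝ Set.univ (f x))
    (h : E₁ → ℝ) (hh : ConvexOn ℝ Set.univ h)
    (g : E₂ → ℝ) (hg : ConvexOn ℝ Set.univ g)
    -- the Lipschitz assumptions
    (Lx : ℝ) (hLx : 0 < Lx)
    (hfx : ∀ x₁ ∈ M, ∀ x₂ ∈ M, ∀ y ∈ S,
      ‖MinimaxManifold.gradX f x₁ y - MinimaxManifold.gradX f x₂ y‖ ≤ Lx * ‖x₁ - x₂‖)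
    (Ly : ℝ) (hLy : 0 < Ly)
    (hfy : ∀ x₁ ∈ M, ∀ x₂ ∈ M, ∀ y₁ ∈ S, ∀ y₂ ∈ S,
      ‖MinimaxManifold.gradY f x₁ y₁ - MinimaxManifold.gradY f x₂ y₂‖ ^ 2
        ≤ Ly ^ 2 * (‖x₁ - x₂‖ ^ 2 + ‖y₁ - y₂‖ ^ 2))
    (Lh : NNReal) (hLh : LipschitzWith Lh h)
    (x : E₁) :
    MinimaxManifold.IsOptimizationStationary M S f h g x ↔
      ∃ y ∈ S, MinimaxManifold.IsGameStationary M S f h g x y := by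
  have hD := MinimaxManifold.clarkeSubdifferential_valueFunction hf hfconc hg hSconv hSc hSne x
  constructor
  · rintro ⟨hx, h0⟩
    obtain ⟨a, ha, ν, hν, hsum⟩ := Set.mem_add.1 h0
    obtain ⟨z, hz, b, hb, rfl⟩ := Set.mem_add.1 ha
    rw [hD] at hz
    obtain ⟨y, ⟨hy, hmax⟩, rfl⟩ := hz
    exact ⟨y, hy, hx, hy, hsum ▸ Set.add_mem_add (Set.add_mem_add rfl hb) hν,
      (MinimaxManifold.isMaxOn_iff_zero_mem hf (hfconc x) hg hSconv hy).1 hmax⟩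
  · rintro ⟨y, hy, hG⟩
    have hmax := (MinimaxManifold.isMaxOn_iff_zero_mem hf (hfconc x) hg hSconv hy).2
      hG.stationary_right
    have hsub : {MinimaxManifold.gradX f x y} ⊆
        MinimaxManifold.clarkeSubdifferential (MinimaxManifold.valueFunction S f g) x := by
      rw [hD, Set.singleton_subset_iff]
      exact ⟨y, ⟨hy, hmax⟩, rfl⟩
    exact ⟨hG.mem_left, Set.add_subset_add_right (Set.add_subset_add_right hsub)
      hG.stationary_left⟩
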